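/- Let $(\Omega,\mathcal F,\mathbb P)$ be a complete probability space, $\vartheta:\Omega\to\Omega$ a $\mathbb P$-preserving transformation, and $(X,d)$ a compact metric space with Borel $\sigma$-algebra $\mathcal B$. Let $\mathcal E\in\mathcal F\otimes\mathcal B$ have nonempty compact fibers $\mathcal E_\omega=\{x:(\omega,x)\in\mathcal E\}$, $\omega\in\Omega$. Let $T$ be a continuous bundle random dynamical system on $\mathcal E$ over $(\Omega,\mathcal F,\mathbb P,\vartheta)$, i.e. a family of maps $T_\omega:\mathcal E_\omega\to\mathcal E_{\vartheta\omega}$ such that $(\omega,x)\mapsto T_\omega x$ is measurable on $\mathcal E$ and $T_\omega$ is continuous for $\mathbb P$-almost all $\omega$. Put $T^0_\omega=\mathrm{id}$ and $T^n_\omega=T_{\vartheta^{n-1}\omega}\circ\cdots\circ T_\omega$. *Entropy.* For $\epsilon>0$ and $n\ge1$ let $\mathrm{sep}(\omega,\epsilon,n)$ be the maximal cardinality of a set $F\subset\mathcal E_\omega$ such that $\max_{0\le k<n} d(T^k_\omega x,T^k_\omega y)\ge\epsilon$ for all $x\ne y$ in $F$. The topological entropy of $T$ is $$h_{\mathrm{top}}(T)=\int_\Omega\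 \lim_{\epsilon\to0}\ \limsup_{n\to\infty}\frac1n\log \mathrm{sep}(\omega,\epsilon,n)\ d\mathbb P(\omega)\in[0,\infty].$$ *Mean dimension.* For a finite open cover $\gamma$ of a nonempty compact space $K$ let $\mathrm{ord}(\gamma)=-1+\sup_{x\in K}\sum_{U\in\gamma}1_U(x)$ and $\mathcal D(\gamma)=\min_\beta \mathrm{ord}(\beta)$, where $\beta$ runs over all finite open covers of $K$ refining $\gamma$. For a finite open cover $\alpha$ of $X$ let $\alpha_0^{n-1}(\omega|\mathcal E)$ be the cover of $\mathcal E_\omega$ consisting of the sets $\bigcap_{i=0}^{n-1}(T^i_\omega)^{-1}(A_i\cap\mathcal E_{\vartheta^i\omega})$ with $A_0,\dots,A_{n-1}\in\alpha$; for $\mathbb P$-almost all $\omega$ these sets are open in $\mathcal E_\omega$ for every $n$. The mean topological dimension of $T$ is $$\mathrm{mdim}(T)=\sup_\alpha\ \lim_{n\to\infty}\frac1n\int_\Omega \mathcal D\big(\alpha_0^{n-1}(\omega|\mathcal E)\big)\,d\mathbb P(\omega),$$ the supremum being over all finite open covers $\alpha$ of $X$. **Corollary.** If $h_{\mathrm{top}}(T)<\infty$,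 then $\mathrm{mdim}(T)=0$. -/

import Mathlib

open Filter Topology MeasureTheory
open scoped ENNReal

noncomputable section

/-! ### Finite open covers, their order, and the invariant `𝒟` -/

/-- `α` is a finite open cover of the topological space `Y`. -/
def IsFiniteOpenCover {Y : Type*} [TopologicalSpace Y] (α : Set (Set Y)) : Prop :=
  α.Finite ∧ (∀ U ∈ α, IsOpen U) ∧ ⋃₀ α = Set.univ

/-- `β ≻ α`: every member of `β` is contained in some member of `α`. -/
def CoverRefines {Y : Type*} (β α : Set (Set Y)) : Prop :=
  ∀ B ∈ β, ∃ A ∈ α, B ⊆ A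

/-- `ord(α) = -1 + sup_x ∑_{U ∈ α} 1_U(x)`. For a cover of a nonempty space the supremum is at
least `1`, so the subtraction in `ℕ∞` is never truncated. -/
def coverOrd {Y : Type*} (α : Set (Set Y)) : ℕ∞ :=
  (⨆ x : Y, {U ∈ α | x ∈ U}.encard) - 1

/-- `𝒟(α) = min ord(β)` over the finite open covers `β` of `Y` that refine `α`. -/
def coverD {Y : Type*} [TopologicalSpace Y] (α : Set (Set Y)) : ℕ∞ :=
  ⨅ (β : Set (Set Y)) (_ : IsFiniteOpenCover β) (_ : CoverRefines β α), coverOrd β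

/-! ### Continuous bundle random dynamical systems -/

/-- A continuous bundle random dynamical system over `(Ω, P, ϑ)` with state space `X`.
The maps `T_ω : E_ω → E_{ϑω}` are given by a function `Ω → X → X`; its values off the bundle `E`
are unconstrained, and no notion below depends on them. -/
structure BundleRDS (Ω X : Type*) [MeasurableSpace Ω] (P : Measure Ω)
    [MetricSpace X] [MeasurableSpace X] where
  /-- the transformation `ϑ` of the base -/
  base : Ω → Ω
  base_measurePreserving : MeasurePreserving base P P
  /-- the bundle `E ⊆ Ω × X` -/
  bundle : Set (Ω × X)
  measurableSet_bundle : MeasurableSet bundle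
  fiber_nonempty : ∀ ω, {x | (ω, x) ∈ bundle}.Nonempty
  fiber_isCompact : ∀ ω, IsCompact {x | (ω, x) ∈ bundle}
  /-- the maps `T_ω` -/
  map : Ω → X → X
  map_mem : ∀ ω x, (ω, x) ∈ bundle → (base ω, map ω x) ∈ bundle
  measurable_map : Measurable fun p : bundle => map p.1.1 p.1.2
  continuousOn_map : ∀ᵐ ω ∂P, ContinuousOn (map ω) {x | (ω, x) ∈ bundle}

namespace BundleRDS

variable {Ω X : Type*} [MeasurableSpace Ω] {P : Measure Ω} [MetricSpace X] [MeasurableSpace X]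

/-- The fiber `E_ω`. -/
def fiber (T : BundleRDS Ω X P) (ω : Ω) : Set X :=
  {x | (ω, x) ∈ T.bundle}

/-- `T_ω^n = T_{ϑ^{n-1}ω} ∘ ⋯ ∘ T_{ϑω} ∘ T_ω`, with `T_ω^0 = id`. -/
def iter (T : BundleRDS Ω X P) : ℕ → Ω → X → X
  | 0, _, x => x
  | n + 1, ω, x => T.map (T.base^[n] ω) (T.iter n ω x)

/-! ### Mean topological dimension -/

/-- The cover `α_0^{n-1}(ω | E)` of the fiber `E_ω`, formed by the sets
`⋂_{i < n} (T_ω^i)⁻¹ (A_i ∩ E_{ϑ^i ω})` with `A_0, …, A_{n-1} ∈ α`. Points of `E_ω` are mapped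
into `E_{ϑ^i ω}` by `T_ω^i`, so the intersection with that fiber need not be written. -/
def iterCover (T : BundleRDS Ω X P) (α : Set (Set X)) (n : ℕ) (ω : Ω) :
    Set (Set (T.fiber ω)) :=
  Set.range fun j : Fin n → α => {x : T.fiber ω | ∀ i : Fin n, T.iter i ω x ∈ (j i : Set X)}

/-- `mdim(T, α) = lim_n (1/n) 𝔼 𝒟(α_0^{n-1}(ω | E))`. The limit exists, by subadditivity;
it is written as an upper limit. -/
def mdimCover (T : BundleRDS Ω X P) (α : Set (Set X)) : ℝ≥0∞ :=
  limsup (fun n : ℕ => (∫⁻ ω, ((coverD (T.iterCover α n ω) : ℕ∞) : ℝ≥0∞) ∂P) / n) atTop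

/-- The mean topological dimension: the supremum of `mdim(T, α)` over finite open covers `α`
of `X`. -/
def mdim (T : BundleRDS Ω X P) : ℝ≥0∞ :=
  ⨆ (α : Set (Set X)) (_ : IsFiniteOpenCover α), T.mdimCover α

/-! ### Topological entropy -/

/-- `d^ω_{ε,n}(x, y) = max_{0 ≤ k < n} d(T_ω^k x, T_ω^k y) / ε(ϑ^k ω)`. -/
def bowenDist (T : BundleRDS Ω X P) (ε : Ω → ℝ) (n : ℕ) (ω : Ω) (x y : X) : ℝ :=
  ⨆ k : Fin n, dist (T.iter k ω x) (T.iter k ω y) / ε (T.base^[k] ω)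

/-- `sep(ω, ε, n)`: the largest cardinality of a set `F ⊆ E_ω` whose distinct points are at
`d^ω_{ε,n}`-distance at least `1`. -/
def sep (T : BundleRDS Ω X P) (ε : Ω → ℝ) (n : ℕ) (ω : Ω) : ℕ∞ :=
  ⨆ (F : Set X) (_ : F ⊆ T.fiber ω)
    (_ : ∀ x ∈ F, ∀ y ∈ F, x ≠ y → 1 ≤ T.bowenDist ε n ω x y), F.encard

/-- `S'(ω, ε) = limsup_n (1/n) log sep(ω, ε, n)`. Fibers are nonempty, so `sep ≥ 1` and the
logarithm is nonnegative. -/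
def sepGrowth (T : BundleRDS Ω X P) (ε : Ω → ℝ) (ω : Ω) : ℝ≥0∞ :=
  limsup (fun n : ℕ => (ENNReal.log ((T.sep ε n ω : ℕ∞) : ℝ≥0∞)).toENNReal / n) atTop

/-- The topological entropy `h_top(T) = 𝔼 lim_{ε → 0} S'(ω, ε)`, over constants `ε > 0`. The
limit exists since `S'(ω, ε)` increases as `ε` decreases; it is written as an upper limit. -/
def topEntropy (T : BundleRDS Ω X P) : ℝ≥0∞ :=
  ∫⁻ ω, limsup (fun ε : ℝ => T.sepGrowth (fun _ => ε) ω) (𝓝[>] (0 : ℝ)) ∂P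

end BundleRDS

end

/-!
Read a point `x` of the fiber through the coordinates `dist (T.iter k ω x) z`, where `k < n` and `z`
runs over a finite net of `X`, and choose a threshold for each coordinate. If at every point at most
`K` coordinates are close to their thresholds, cut the fiber according to the sides of the
thresholds on which the other coordinates lie; grouping the points by the coordinates closest to
their thresholds gives an open cover of order at most `K` that refines the iterated cover.

The thresholds are found by counting. On a grid of `L` values at least `4 * ε` apart, a point is
close to at most one value per coordinate, so only a fraction `L⁻¹ ^ (K + 1)` of the choices is bad
for a given point and a given set of `K + 1` coordinates. With finite entropy there are
exponentially many points to consider, and exponentially many sets of coordinates, say `B ^ n` pairs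
in all with `B` independent of `ε`. Hence `K ≈ n / q` works once `L = B ^ q`, which a small `ε`
allows, and `𝒟 / n → 0` on almost every fiber of finite entropy. The integrals converge too, as
`𝒟 / n` is bounded by the size of the net.
-/

open scoped Finset

section SignCell

variable {Y ι : Type*}

/-- The set of points `y` at which the coordinates `c` with `σ c = 0` are those where `|u c y|` is
smallest, all of them being less than `η`, and at which the other coordinates have the sign
prescribed by `σ`. -/
def signCell (u : ι → Y → ℝ) (η : ℝ) (σ : ι → SignType) : Set Y :=
  {y | ∀ c, (σ c = 0 → |u c y| < η ∧ ∀ d, σ d ≠ 0 → |u c y| < |u d y|) ∧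
    (σ c ≠ 0 → SignType.sign (u c y) = σ c)}

theorem isOpen_signCell [TopologicalSpace Y] [Finite ι] {u : ι → Y → ℝ}
    (hu : ∀ c, Continuous (u c)) (η : ℝ) (σ : ι → SignType) : IsOpen (signCell u η σ) := by
  have isOpen_sign (c : ι) : IsOpen {y | σ c ≠ 0 → SignType.sign (u c y) = σ c} := by
    cases σ c
    · simp
    · simpa [sign_eq_neg_one_iff] using isOpen_lt (hu c) continuous_const
    · simpa [sign_eq_one_iff] using isOpen_lt continuous_const (hu c)
  simp only [signCell, Set.ofPred_forall, Set.ofPred_and]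
  refine isOpen_iInter_of_finite fun c => IsOpen.inter ?_ ?_
  · exact isOpen_iInter_of_finite fun _ => (isOpen_lt (hu c).abs continuous_const).inter <|
      isOpen_iInter_of_finite fun d => isOpen_iInter_of_finite fun _ =>
        isOpen_lt (hu c).abs (hu d).abs
  · simpa only [Set.ofPred_forall] using isOpen_sign c

theorem exists_mem_signCell (u : ι → Y → ℝ) {η : ℝ} (hη : 0 < η) (y : Y) :
    ∃ σ : ι → SignType, {c | σ c = 0} = {c | |u c y| < η} ∧ y ∈ signCell u η σ := by
  classical
  let σ : ι → SignType := fun c => if |u c y| < η then 0 else SignType.sign (u c y)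
  have hσ (c : ι) : σ c = 0 ↔ |u c y| < η := by
    by_cases hc : |u c y| < η
    · simp [σ, hc]
    · have : u c y ≠ 0 := fun h0 => hc (by simpa [h0] using hη)
      simp [σ, hc, this]
  refine ⟨σ, Set.ext hσ, fun c => ⟨fun hc => ⟨(hσ c).1 hc, fun d hd => ?_⟩, fun hc => ?_⟩⟩
  · exact ((hσ c).1 hc).trans_le (not_lt.1 (mt (hσ d).2 hd))
  · exact (if_neg (mt (hσ c).2 hc)).symm

/-- The zero sets of two cells through `y` are nested, as both consist of the coordinates with the
smallest `|u c y|`. -/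
theorem eq_of_mem_signCell_of_ncard_eq [Finite ι] {u : ι → Y → ℝ} {η : ℝ} {σ τ : ι → SignType}
    {y : Y} (hσ : y ∈ signCell u η σ) (hτ : y ∈ signCell u η τ)
    (hcard : {c | σ c = 0}.ncard = {c | τ c = 0}.ncard) : σ = τ := by
  have hzero : {c | σ c = 0} = {c | τ c = 0} := by
    by_contra hne
    have hστ : ¬ {c | σ c = 0} ⊆ {c | τ c = 0} := fun h =>
      hne (Set.eq_of_subset_of_ncard_le h hcard.ge (Set.toFinite _))
    have hτσ : ¬ {c | τ c = 0} ⊆ {c | σ c = 0} := fun h =>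
      hne (Set.eq_of_subset_of_ncard_le h hcard.le (Set.toFinite _)).symm
    obtain ⟨c, hcσ, hcτ⟩ := Set.not_subset.1 hστ
    obtain ⟨d, hdτ, hdσ⟩ := Set.not_subset.1 hτσ
    exact lt_asymm (((hσ c).1 hcσ).2 d hdσ) (((hτ d).1 hdτ).2 c hcτ)
  funext c
  have hc : σ c = 0 ↔ τ c = 0 := Set.ext_iff.1 hzero c
  by_cases h0 : σ c = 0
  · rw [h0, hc.1 h0]
  · rw [← (hσ c).2 h0, (hτ c).2 (mt hc.2 h0)]

theorem forall_lt_or_forall_neg_lt_of_signCell (u : ι → Y → ℝ) {η : ℝ} (hη : 0 < η)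
    (σ : ι → SignType) (c : ι) :
    (∀ y ∈ signCell u η σ, u c y < η) ∨ ∀ y ∈ signCell u η σ, -η < u c y := by
  rcases hc : σ c with _ | _ | _
  · exact .inl fun y hy => (abs_lt.1 ((hy c).1 hc).1).2
  · refine .inl fun y hy => lt_trans ?_ hη
    exact sign_eq_neg_one_iff.1 (((hy c).2 (by simp [hc])).trans hc)
  · refine .inr fun y hy => lt_trans (neg_lt_zero.2 hη) ?_
    exact sign_eq_one_iff.1 (((hy c).2 (by simp [hc])).trans hc)

theorem coverOrd_image_signCell_le [Finite ι] (u : ι → Y → ℝ) (η : ℝ) (K : ℕ) :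
    coverOrd (signCell u η '' {σ | {c | σ c = 0}.ncard ≤ K}) ≤ K := by
  refine tsub_le_iff_right.2 (iSup_le fun y => ?_)
  let cellsAt : Set (ι → SignType) := {σ | {c | σ c = 0}.ncard ≤ K ∧ y ∈ signCell u η σ}
  have hsub : {U ∈ signCell u η '' {σ | {c | σ c = 0}.ncard ≤ K} | y ∈ U} ⊆
      signCell u η '' cellsAt := by
    rintro _ ⟨⟨σ, hσ, rfl⟩, hy⟩
    exact ⟨σ, ⟨hσ, hy⟩, rfl⟩
  calc {U ∈ signCell u η '' {σ | {c | σ c = 0}.ncard ≤ K} | y ∈ U}.encard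
      ≤ cellsAt.encard := (Set.encard_le_encard hsub).trans (Set.encard_image_le _ _)
    _ ≤ (Set.Iic K).encard :=
        Set.encard_le_encard_of_injOn (f := fun σ => {c | σ c = 0}.ncard) (fun _ hσ => hσ.1)
          fun _ hσ _ hτ => eq_of_mem_signCell_of_ncard_eq hσ.2 hτ.2
    _ = K + 1 := by simp [Set.encard_eq_coe_toFinset_card]

theorem exists_isFiniteOpenCover_coverOrd_le [TopologicalSpace Y] [Finite ι] {u : ι → Y → ℝ}
    (hu : ∀ c, Continuous (u c)) {η : ℝ} (hη : 0 < η) {K : ℕ}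
    (hK : ∀ y, {c | |u c y| < η}.ncard ≤ K) :
    ∃ β : Set (Set Y), IsFiniteOpenCover β ∧ coverOrd β ≤ K ∧
      ∀ B ∈ β, ∀ c, (∀ y ∈ B, u c y < η) ∨ ∀ y ∈ B, -η < u c y := by
  refine ⟨signCell u η '' {σ | {c | σ c = 0}.ncard ≤ K}, ⟨(Set.toFinite _).image _, ?_, ?_⟩,
    coverOrd_image_signCell_le u η K, ?_⟩
  · exact Set.forall_mem_image.2 fun σ _ => isOpen_signCell hu η σ
  · refine Set.eq_univ_of_forall fun y => ?_
    obtain ⟨σ, hσ, hy⟩ := exists_mem_signCell u hη y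
    exact ⟨_, ⟨σ, (congrArg Set.ncard hσ).trans_le (hK y), rfl⟩, hy⟩
  · exact Set.forall_mem_image.2 fun σ _ => forall_lt_or_forall_neg_lt_of_signCell u hη σ

end SignCell

section Counting

variable {ι A κ : Type*} [Fintype ι] [Fintype A]

open Classical in
theorem card_filter_forall_mem_mul_pow_le {R : ι → A → Prop} (hR : ∀ c, {a | R c a}.Subsingleton)
    (S : Finset ι) :
    #{ξ : ι → A | ∀ c ∈ S, R c (ξ c)} * Fintype.card A ^ #S ≤
      Fintype.card A ^ Fintype.card ι := by
  have hpi : ({ξ : ι → A | ∀ c ∈ S, R c (ξ c)} : Finset (ι → A)) =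
      Fintype.piFinset fun c => if c ∈ S then ({a | R c a} : Finset A) else Finset.univ := by
    ext ξ
    simp only [Finset.mem_filter_univ, Fintype.mem_piFinset]
    refine forall_congr' fun c => ?_
    split_ifs with hc <;> simp [hc]
  have hcard (c : ι) : #({a | R c a} : Finset A) ≤ 1 :=
    Finset.card_le_one.2 fun a ha b hb => hR c (by simpa using ha) (by simpa using hb)
  calc #{ξ : ι → A | ∀ c ∈ S, R c (ξ c)} * Fintype.card A ^ #S
      = ∏ c, (#(if c ∈ S then ({a | R c a} : Finset A) else Finset.univ) *
          if c ∈ S then Fintype.card A else 1) := by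
        rw [hpi, Fintype.card_piFinset, Finset.prod_mul_distrib, Finset.prod_ite_mem_eq,
          Finset.prod_const]
    _ ≤ ∏ _c : ι, Fintype.card A := by
        refine Finset.prod_le_prod' fun c _ => ?_
        split_ifs
        · simpa using Nat.mul_le_mul_right (Fintype.card A) (hcard c)
        · simp
    _ = Fintype.card A ^ Fintype.card ι := by simp

open Classical in
theorem card_filter_lt_ncard_mul_pow_le {R : ι → A → Prop} (hR : ∀ c, {a | R c a}.Subsingleton)
    (K : ℕ) :
    #{ξ : ι → A | K < {c | R c (ξ c)}.ncard} * Fintype.card A ^ (K + 1) ≤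
      2 ^ Fintype.card ι * Fintype.card A ^ Fintype.card ι := by
  have hsub : ({ξ : ι → A | K < {c | R c (ξ c)}.ncard} : Finset (ι → A)) ⊆
      (Finset.univ.powersetCard (K + 1)).biUnion fun S => {ξ | ∀ c ∈ S, R c (ξ c)} := by
    intro ξ hξ
    rw [Finset.mem_filter_univ, Set.ncard_eq_toFinset_card'] at hξ
    obtain ⟨S, hS, hScard⟩ := Finset.exists_subset_card_eq (Nat.succ_le_of_lt hξ)
    simp only [Finset.mem_biUnion, Finset.mem_powersetCard_univ, Finset.mem_filter_univ]
    exact ⟨S, hScard, fun c hc => by simpa using hS hc⟩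
  calc #{ξ : ι → A | K < {c | R c (ξ c)}.ncard} * Fintype.card A ^ (K + 1)
      ≤ (∑ S ∈ Finset.univ.powersetCard (K + 1), #{ξ : ι → A | ∀ c ∈ S, R c (ξ c)}) *
          Fintype.card A ^ (K + 1) := by
        gcongr
        exact (Finset.card_le_card hsub).trans Finset.card_biUnion_le
    _ ≤ ∑ _S ∈ (Finset.univ : Finset ι).powersetCard (K + 1),
          Fintype.card A ^ Fintype.card ι := by
        rw [Finset.sum_mul]
        refine Finset.sum_le_sum fun S hS => ?_
        rw [← Finset.mem_powersetCard_univ.1 hS]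
        exact card_filter_forall_mem_mul_pow_le hR S
    _ ≤ 2 ^ Fintype.card ι * Fintype.card A ^ Fintype.card ι := by
        rw [Finset.sum_const, Finset.card_powersetCard, Finset.card_univ, smul_eq_mul]
        gcongr
        exact Nat.choose_le_two_pow _ _

theorem exists_forall_mem_ncard_le (F : Finset κ) {R : κ → ι → A → Prop}
    (hR : ∀ y c, {a | R y c a}.Subsingleton) {K : ℕ}
    (hcard : #F * 2 ^ Fintype.card ι < Fintype.card A ^ (K + 1)) :
    ∃ ξ : ι → A, ∀ y ∈ F, {c | R y c (ξ c)}.ncard ≤ K := by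
  classical
  by_contra! hbad
  have hcover : (Finset.univ : Finset (ι → A)) ⊆
      F.biUnion fun y => {ξ | K < {c | R y c (ξ c)}.ncard} := fun ξ _ => by simpa using hbad ξ
  have hle : Fintype.card A ^ Fintype.card ι * Fintype.card A ^ (K + 1) ≤
      Fintype.card A ^ Fintype.card ι * (#F * 2 ^ Fintype.card ι) := by
    calc Fintype.card A ^ Fintype.card ι * Fintype.card A ^ (K + 1)
        = #(Finset.univ : Finset (ι → A)) * Fintype.card A ^ (K + 1) := by simp
      _ ≤ (∑ y ∈ F, #{ξ : ι → A | K < {c | R y c (ξ c)}.ncard}) * Fintype.card A ^ (K + 1) := by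
          gcongr
          exact (Finset.card_le_card hcover).trans Finset.card_biUnion_le
      _ ≤ ∑ _y ∈ F, 2 ^ Fintype.card ι * Fintype.card A ^ Fintype.card ι := by
          rw [Finset.sum_mul]
          exact Finset.sum_le_sum fun y _ => card_filter_lt_ncard_mul_pow_le (hR y) K
      _ = Fintype.card A ^ Fintype.card ι * (#F * 2 ^ Fintype.card ι) := by
          rw [Finset.sum_const, smul_eq_mul]
          ring
  have hApos : 0 < Fintype.card A := Nat.pos_of_ne_zero fun h0 => by simp [h0] at hcard
  exact hcard.not_ge (Nat.le_of_mul_le_mul_left hle (pow_pos hApos _))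

end Counting

theorem eq_of_abs_sub_grid_lt {v t r : ℝ} {a b : ℕ} (ha : |v - (t + 2 * r * a)| < r)
    (hb : |v - (t + 2 * r * b)| < r) : a = b := by
  wlog hab : a < b generalizing a b
  · by_contra hne
    exact hne (this hb ha (lt_of_le_of_ne (not_lt.1 hab) (Ne.symm hne))).symm
  have hr : 0 < r := (abs_nonneg _).trans_lt ha
  have hcast : (a : ℝ) + 1 ≤ b := by exact_mod_cast hab
  nlinarith [(abs_lt.1 ha).2, (abs_lt.1 hb).1]

theorem exists_finset_forall_exists_not_rel {X : Type*} {r : X → X → Prop}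
    (hsymm : ∀ x y, r x y → r y x) (hirrefl : ∀ x, ¬ r x x) {E : Set X}
    (htop : ⨆ (F : Set X) (_ : F ⊆ E) (_ : F.Pairwise r), F.encard ≠ ⊤) :
    ∃ F : Finset X, (#F : ℕ∞) ≤ ⨆ (F : Set X) (_ : F ⊆ E) (_ : F.Pairwise r), F.encard ∧
      ∀ x ∈ E, ∃ y ∈ F, ¬ r x y := by
  obtain ⟨F, hF⟩ := zorn_subset {F : Set X | F ⊆ E ∧ F.Pairwise r} fun c hc hchain =>
    ⟨⋃₀ c, ⟨Set.sUnion_subset fun F hF => (hc hF).1,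
      (Set.pairwise_sUnion hchain.directedOn).2 fun F hF => (hc hF).2⟩,
      fun F hF => Set.subset_sUnion_of_mem hF⟩
  have hle : F.encard ≤ ⨆ (F : Set X) (_ : F ⊆ E) (_ : F.Pairwise r), F.encard :=
    le_iSup₂_of_le F hF.prop.1 (le_iSup_of_le hF.prop.2 le_rfl)
  have hfin : F.Finite := Set.encard_ne_top_iff.1 (ne_top_of_le_ne_top htop hle)
  refine ⟨hfin.toFinset, hfin.encard_eq_coe_toFinset_card ▸ hle, fun x hx => ?_⟩
  by_contra! hall
  simp only [Set.Finite.mem_toFinset] at hall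
  have hxF : x ∉ F := fun h => hirrefl x (hall x h)
  have hinsert : (insert x F).Pairwise r := (Set.pairwise_insert_of_notMem hxF).2
    ⟨hF.prop.2, fun y hy => ⟨hall y hy, hsymm _ _ (hall y hy)⟩⟩
  exact hxF (hF.le_of_ge ⟨Set.insert_subset hx hF.prop.1, hinsert⟩ (Set.subset_insert x F)
    (Set.mem_insert x F))

theorem le_three_pow_of_toENNReal_log_le {x : ℝ≥0∞} {m : ℕ}
    (h : (ENNReal.log x).toENNReal ≤ m) : x ≤ 3 ^ m := by
  have hlog : ENNReal.log x ≤ m * (1 : ℝ) :=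
    calc ENNReal.log x ≤ (ENNReal.log x).toENNReal :=
        (le_max_right _ _).trans_eq EReal.coe_toENNReal_eq_max.symm
      _ ≤ ((m : ℝ≥0∞) : EReal) := EReal.coe_ennreal_le_coe_ennreal_iff.2 h
      _ = m * (1 : ℝ) := by
        rw [← ENNReal.ofReal_natCast, EReal.coe_ennreal_ofReal, max_eq_left (Nat.cast_nonneg m),
          EReal.coe_coe_eq_natCast, EReal.coe_one, mul_one]
  calc x = EReal.exp (ENNReal.log x) := (ENNReal.exp_log x).symm
    _ ≤ EReal.exp (m * (1 : ℝ)) := EReal.exp_monotone hlog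
    _ = ENNReal.ofReal (Real.exp 1) ^ m := by rw [EReal.exp_nmul, EReal.exp_coe]
    _ ≤ 3 ^ m := by
        gcongr
        exact ENNReal.ofReal_le_of_le_toReal (by simpa using Real.exp_one_lt_three.le)

theorem tendsto_div_natCast_zero_of_forall_eventually_mul_le {a : ℕ → ℝ≥0∞}
    (h : ∀ q : ℕ, 0 < q → ∀ᶠ n : ℕ in atTop, q * a n ≤ n) :
    Tendsto (fun n : ℕ => a n / n) atTop (𝓝 0) := by
  refine ENNReal.tendsto_nhds_zero.2 fun ε hε => ?_
  obtain ⟨q, hq⟩ := ENNReal.exists_inv_nat_lt hε.ne'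
  filter_upwards [h (q + 1) q.succ_pos] with n hn
  calc a n / n ≤ ((q + 1 : ℕ) : ℝ≥0∞)⁻¹ := by
        refine ENNReal.div_le_of_le_mul ?_
        rwa [mul_comm, ← div_eq_mul_inv, ENNReal.le_div_iff_mul_le (.inl (by simp))
          (.inl (ENNReal.natCast_ne_top _)), mul_comm]
    _ ≤ (q : ℝ≥0∞)⁻¹ := ENNReal.inv_le_inv.2 (by exact_mod_cast q.le_succ)
    _ ≤ ε := hq.le

section LowerIntegral

variable {Ω : Type*} [MeasurableSpace Ω] {μ : Measure Ω}

theorem limsup_lintegral_le_lintegral_limsup {g : ℕ → Ω → ℝ≥0∞} {bound : Ω → ℝ≥0∞}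
    (hbound : ∀ n, g n ≤ᵐ[μ] bound) (hfin : ∫⁻ ω, bound ω ∂μ ≠ ⊤) :
    limsup (fun n => ∫⁻ ω, g n ω ∂μ) atTop ≤ ∫⁻ ω, limsup (fun n => g n ω) atTop ∂μ := by
  choose φ hφ_meas hφ_le hφ_eq using fun n => exists_measurable_le_lintegral_eq μ (g n)
  calc limsup (fun n => ∫⁻ ω, g n ω ∂μ) atTop
      = limsup (fun n => ∫⁻ ω, φ n ω ∂μ) atTop := by simp only [hφ_eq]
    _ ≤ ∫⁻ ω, limsup (fun n => φ n ω) atTop ∂μ :=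
        limsup_lintegral_le bound hφ_meas
          (fun n => (hbound n).mono fun ω => (hφ_le n ω).trans) hfin
    _ ≤ ∫⁻ ω, limsup (fun n => g n ω) atTop ∂μ :=
        lintegral_mono fun ω => limsup_le_limsup (.of_forall fun n => hφ_le n ω)

theorem lintegral_eq_zero_of_ae_ne_zero_imp_mem {f : Ω → ℝ≥0∞} {S : Set Ω}
    (hf : ∀ᵐ ω ∂μ, f ω ≠ 0 → ω ∈ S) (hS : ∀ A ⊆ S, MeasurableSet A → μ A = 0) :
    ∫⁻ ω, f ω ∂μ = 0 := by
  obtain ⟨φ, hφ_meas, hφ_le, hφ_eq⟩ := exists_measurable_le_lintegral_eq μ f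
  obtain ⟨G, hG, hG_meas, hGS⟩ := hf.exists_measurable_mem
  have hnull : μ ({ω | φ ω ≠ 0} ∩ G) = 0 := by
    refine hS _ (fun ω hω => hGS ω hω.2 fun h0 => hω.1 ?_)
      ((hφ_meas (measurableSet_singleton 0)).compl.inter hG_meas)
    exact le_antisymm ((hφ_le ω).trans_eq h0) bot_le
  rw [hφ_eq, lintegral_eq_zero_iff hφ_meas]
  filter_upwards [hG, measure_eq_zero_iff_ae_notMem.1 hnull] with ω hωG hω
  by_contra hne
  exact hω ⟨hne, hωG⟩

theorem measure_eq_zero_of_subset_setOf_eq_top {f : Ω → ℝ≥0∞} (hf : ∫⁻ ω, f ω ∂μ ≠ ⊤) {A : Set Ω}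
    (hA : MeasurableSet A) (hAf : A ⊆ {ω | f ω = ⊤}) : μ A = 0 := by
  by_contra hne
  refine hf (top_le_iff.1 ?_)
  calc ⊤ = ∫⁻ ω, A.indicator (fun _ => ⊤) ω ∂μ := by
        rw [lintegral_indicator_const hA, ENNReal.top_mul hne]
    _ ≤ ∫⁻ ω, f ω ∂μ :=
        lintegral_mono (Set.indicator_le fun ω hω => (hAf hω).ge)

end LowerIntegral

section SubordinateNet

variable {X : Type*} [PseudoMetricSpace X] {α : Set (Set X)}

/-- `s` is a finite `ρ`-net of the space such that the `δ`-ball about each point of `s` lies in a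
member of `α`. -/
structure IsSubordinateNet (α : Set (Set X)) (ρ δ : ℝ) (s : Finset X) : Prop where
  exists_dist_lt : ∀ x, ∃ z ∈ s, dist x z < ρ
  exists_ball_subset : ∀ z ∈ s, ∃ A ∈ α, Metric.ball z δ ⊆ A

theorem IsFiniteOpenCover.exists_isSubordinateNet [CompactSpace X] (hα : IsFiniteOpenCover α) :
    ∃ ρ δ : ℝ, ρ < δ ∧ ∃ s : Finset X, IsSubordinateNet α ρ δ s := by
  obtain ⟨δ, hδ, hball⟩ :=
    lebesgue_number_lemma_of_metric_sUnion isCompact_univ hα.2.1 hα.2.2.ge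
  obtain ⟨s, -, hs, hcover⟩ :=
    finite_cover_balls_of_compact (isCompact_univ (X := X)) (half_pos hδ)
  lift s to Finset X using hs
  exact ⟨δ / 2, δ, half_lt_self hδ, s, fun x => by simpa using hcover (Set.mem_univ x),
    fun z _ => hball z (Set.mem_univ z)⟩

theorem IsSubordinateNet.exists_subset [Nonempty X] {ρ δ : ℝ} {s : Finset X}
    (hs : IsSubordinateNet α ρ δ s) {W : Set X}
    (hW : ∀ z ∈ s, (∀ x ∈ W, dist x z < δ) ∨ ∀ x ∈ W, ρ ≤ dist x z) :
    ∃ A ∈ α, W ⊆ A := by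
  obtain ⟨x, hx⟩ : ∃ x, W.Nonempty → x ∈ W := by
    rcases W.eq_empty_or_nonempty with rfl | ⟨x, hx⟩
    · simp
    · exact ⟨x, fun _ => hx⟩
  obtain ⟨z, hz, hxz⟩ := hs.exists_dist_lt x
  obtain ⟨A, hA, hzA⟩ := hs.exists_ball_subset z hz
  refine ⟨A, hA, fun y hy => hzA ?_⟩
  rcases hW z hz with hnear | hfar
  · exact hnear y hy
  · exact absurd hxz (hfar x (hx ⟨y, hy⟩)).not_gt

end SubordinateNet

namespace BundleRDS

variable {Ω X : Type*} [MeasurableSpace Ω] {P : Measure Ω} [MetricSpace X] [MeasurableSpace X]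
  (T : BundleRDS Ω X P)

/-- The fiber entropy `lim_{ε → 0} S'(ω, ε)`, whose integral over `ω` is the topological
entropy. -/
noncomputable def fiberEntropy (ω : Ω) : ℝ≥0∞ :=
  limsup (fun ε : ℝ => T.sepGrowth (fun _ => ε) ω) (𝓝[>] (0 : ℝ))

theorem iter_mem_fiber (n : ℕ) {ω : Ω} {x : X} (hx : x ∈ T.fiber ω) :
    T.iter n ω x ∈ T.fiber (T.base^[n] ω) := by
  induction n with
  | zero => exact hx
  | succ n ih =>
    rw [Function.iterate_succ_apply']
    exact T.map_mem _ _ ih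

theorem ae_continuousOn_iter : ∀ᵐ ω ∂P, ∀ n, ContinuousOn (T.iter n ω) (T.fiber ω) := by
  have hmap : ∀ᵐ ω ∂P, ∀ n, ContinuousOn (T.map (T.base^[n] ω)) (T.fiber (T.base^[n] ω)) :=
    ae_all_iff.2 fun n =>
      (T.base_measurePreserving.iterate n).quasiMeasurePreserving.ae T.continuousOn_map
  filter_upwards [hmap] with ω hω n
  induction n with
  | zero => exact continuousOn_id
  | succ n ih => exact (hω n).comp ih fun x hx => T.iter_mem_fiber n hx

theorem exists_finset_bowenDist_lt_one (ε : Ω → ℝ) (n : ℕ) (ω : Ω) (hsep : T.sep ε n ω ≠ ⊤) :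
    ∃ F : Finset X, (#F : ℕ∞) ≤ T.sep ε n ω ∧
      ∀ x ∈ T.fiber ω, ∃ y ∈ F, T.bowenDist ε n ω x y < 1 := by
  have hsymm (x y : X) : T.bowenDist ε n ω x y = T.bowenDist ε n ω y x := by
    simp only [bowenDist, dist_comm]
  have hself (x : X) : T.bowenDist ε n ω x x = 0 := by simp [bowenDist]
  obtain ⟨F, hF, hspan⟩ := exists_finset_forall_exists_not_rel
    (r := fun x y => 1 ≤ T.bowenDist ε n ω x y) (fun x y h => hsymm x y ▸ h)
    (fun x => by simp [hself]) hsep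
  exact ⟨F, hF, by simpa only [not_le] using hspan⟩

theorem dist_iter_lt_of_bowenDist_lt_one {ε : Ω → ℝ} {n k : ℕ} (hk : k < n) {ω : Ω}
    (hε : 0 < ε (T.base^[k] ω)) {x y : X} (h : T.bowenDist ε n ω x y < 1) :
    dist (T.iter k ω x) (T.iter k ω y) < ε (T.base^[k] ω) := by
  rw [← div_lt_one hε]
  exact (le_ciSup (f := fun k : Fin n => dist (T.iter k ω x) (T.iter k ω y) / ε (T.base^[k] ω))
    (Set.finite_range _).bddAbove ⟨k, hk⟩).trans_lt h

theorem eventually_sep_le_three_pow {ε : Ω → ℝ} {ω : Ω} {C : ℕ} (hC : T.sepGrowth ε ω < C) :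
    ∀ᶠ n : ℕ in atTop, T.sep ε n ω ≤ (3 ^ (C * n) : ℕ) := by
  filter_upwards [eventually_lt_of_limsup_lt hC, eventually_ne_atTop 0] with n hlog hn
  have hle : (ENNReal.log (T.sep ε n ω)).toENNReal ≤ ((C * n : ℕ) : ℝ≥0∞) := by
    simpa using (ENNReal.div_le_iff (by simpa using hn) (by simp)).1 hlog.le
  exact_mod_cast le_three_pow_of_toENNReal_log_le hle

section CoverBounds

variable {T} {α : Set (Set X)} {ρ δ : ℝ} {s : Finset X} {ω : Ω}

theorem coverD_iterCover_le_of_thresholds (hs : IsSubordinateNet α ρ δ s)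
    (hω : ∀ n, ContinuousOn (T.iter n ω) (T.fiber ω)) {n K : ℕ} {ε : ℝ} (hε : 0 < ε)
    {ξ : Fin n × s → ℝ} (hξ_ge : ∀ c, ρ + ε ≤ ξ c) (hξ_le : ∀ c, ξ c + ε ≤ δ)
    (hK : ∀ x ∈ T.fiber ω, {c | |dist (T.iter c.1 ω x) c.2 - ξ c| < ε}.ncard ≤ K) :
    coverD (T.iterCover α n ω) ≤ K := by
  obtain ⟨β, hβ, hord, hsep⟩ := exists_isFiniteOpenCover_coverOrd_le
    (u := fun (c : Fin n × s) (x : T.fiber ω) => dist (T.iter c.1 ω x) c.2 - ξ c)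
    (fun c => ((continuousOn_iff_continuous_domRestrict.1 (hω c.1)).dist continuous_const).sub
      continuous_const) hε fun x => hK x x.2
  refine iInf₂_le_of_le β hβ (iInf_le_of_le (fun B hB => ?_) hord)
  have : Nonempty X := (T.fiber_nonempty ω).to_type
  have hα (i : Fin n) : ∃ A ∈ α, (fun x : T.fiber ω => T.iter i ω x) '' B ⊆ A := by
    refine hs.exists_subset fun z hz => ?_
    simp only [Set.forall_mem_image]
    refine (hsep B hB (i, ⟨z, hz⟩)).imp (fun h x hx => ?_) fun h x hx => ?_
    · linarith [h x hx, hξ_le (i, ⟨z, hz⟩)]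
    · linarith [h x hx, hξ_ge (i, ⟨z, hz⟩)]
  choose A hA hBA using hα
  exact ⟨_, ⟨fun i => ⟨A i, hA i⟩, rfl⟩, fun x hx i => hBA i ⟨x, hx, rfl⟩⟩

theorem coverD_iterCover_le_mul_card (hρδ : ρ < δ) (hs : IsSubordinateNet α ρ δ s)
    (hω : ∀ n, ContinuousOn (T.iter n ω) (T.fiber ω)) (n : ℕ) :
    coverD (T.iterCover α n ω) ≤ (n * #s : ℕ) := by
  refine coverD_iterCover_le_of_thresholds hs hω (ε := (δ - ρ) / 2) (ξ := fun _ => (ρ + δ) / 2)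
    (by linarith) (fun _ => by linarith) (fun _ => by linarith) fun x _ => ?_
  calc _ ≤ (Set.univ : Set (Fin n × s)).ncard := Set.ncard_le_ncard (Set.subset_univ _)
    _ = n * #s := by simp [Set.ncard_univ]

theorem coverD_iterCover_le_of_sep_le (hs : IsSubordinateNet α ρ δ s)
    (hω : ∀ n, ContinuousOn (T.iter n ω) (T.fiber ω)) {n K L N : ℕ} {ε : ℝ} (hε : 0 < ε)
    (hL : ρ + 4 * ε * L ≤ δ) (hN : T.sep (fun _ => ε) n ω ≤ N)
    (hcard : N * 2 ^ (n * #s) < L ^ (K + 1)) :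
    coverD (T.iterCover α n ω) ≤ K := by
  obtain ⟨F, hFsep, hspan⟩ := T.exists_finset_bowenDist_lt_one (fun _ => ε) n ω
    (ne_top_of_le_ne_top (ENat.natCast_ne_top N) hN)
  have hF : #F * 2 ^ (n * #s) < L ^ (K + 1) :=
    lt_of_le_of_lt (Nat.mul_le_mul_right _ (by exact_mod_cast hFsep.trans hN)) hcard
  obtain ⟨a, ha⟩ := exists_forall_mem_ncard_le (ι := Fin n × s) (A := Fin L) F
    (R := fun y c a => |dist (T.iter c.1 ω y) c.2 - (ρ + ε + 2 * (2 * ε) * (a : ℕ))| < 2 * ε)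
    (fun y c a ha b hb => Fin.ext (eq_of_abs_sub_grid_lt ha hb)) (by simpa using hF)
  refine coverD_iterCover_le_of_thresholds hs hω hε
    (ξ := fun c => ρ + ε + 2 * (2 * ε) * (a c : ℕ)) (fun c => ?_) (fun c => ?_) fun x hx => ?_
  · have : 0 ≤ 2 * (2 * ε) * ((a c : ℕ) : ℝ) := by positivity
    linarith
  · have : ((a c : ℕ) : ℝ) + 1 ≤ L := by exact_mod_cast (a c).2
    nlinarith
  · obtain ⟨y, hy, hxy⟩ := hspan x hx
    refine (Set.ncard_le_ncard fun c hc => ?_).trans (ha y hy)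
    have hc : |dist (T.iter c.1 ω x) c.2 - (ρ + ε + 2 * (2 * ε) * (a c : ℕ))| < ε := hc
    have hiter := T.dist_iter_lt_of_bowenDist_lt_one c.1.2 hε hxy
    have htri := abs_dist_sub_le (T.iter c.1 ω y) (T.iter c.1 ω x) (c.2 : X)
    rw [dist_comm (T.iter c.1 ω y) (T.iter c.1 ω x)] at htri
    calc _ ≤ |dist (T.iter c.1 ω y) c.2 - dist (T.iter c.1 ω x) c.2| +
          |dist (T.iter c.1 ω x) c.2 - (ρ + ε + 2 * (2 * ε) * (a c : ℕ))| := abs_sub_le _ _ _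
      _ < 2 * ε := by linarith

theorem eventually_mul_coverD_iterCover_le (hρδ : ρ < δ) (hs : IsSubordinateNet α ρ δ s)
    (hω : ∀ n, ContinuousOn (T.iter n ω) (T.fiber ω)) (hfin : T.fiberEntropy ω ≠ ⊤) {q : ℕ}
    (hq : 0 < q) : ∀ᶠ n : ℕ in atTop, q * coverD (T.iterCover α n ω) ≤ n := by
  obtain ⟨C, hC⟩ := ENNReal.exists_nat_gt hfin
  have hCpos : C ≠ 0 := by
    rintro rfl
    simp at hC
  let B : ℕ := 3 ^ C * 2 ^ #s
  have hB : 1 < B :=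
    (Nat.one_lt_pow hCpos (by norm_num)).trans_le (Nat.le_mul_of_pos_right _ (by positivity))
  have hsmall : ∀ᶠ ε : ℝ in 𝓝[>] 0, ε ≤ (δ - ρ) / (4 * (B ^ q : ℕ)) :=
    nhdsWithin_le_nhds (Iic_mem_nhds (div_pos (sub_pos.2 hρδ) (by positivity)))
  obtain ⟨ε, hεC, hεδ, hε⟩ :=
    ((eventually_lt_of_limsup_lt hC).and (hsmall.and self_mem_nhdsWithin)).exists
  rw [le_div_iff₀ (by positivity)] at hεδ
  filter_upwards [T.eventually_sep_le_three_pow hεC] with n hn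
  have hcount : 3 ^ (C * n) * 2 ^ (n * #s) < (B ^ q) ^ (n / q + 1) :=
    calc 3 ^ (C * n) * 2 ^ (n * #s) = B ^ n := by
          rw [mul_pow, ← pow_mul, ← pow_mul, mul_comm n]
      _ < B ^ (q * (n / q + 1)) := Nat.pow_lt_pow_right hB (Nat.lt_mul_div_succ n hq)
      _ = (B ^ q) ^ (n / q + 1) := pow_mul _ _ _
  calc q * coverD (T.iterCover α n ω) ≤ q * (n / q : ℕ) := by
        gcongr
        exact coverD_iterCover_le_of_sep_le hs hω hε (by linarith) hn hcount
    _ ≤ n := by exact_mod_cast Nat.mul_div_le n q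

theorem tendsto_coverD_iterCover_div (hρδ : ρ < δ) (hs : IsSubordinateNet α ρ δ s)
    (hω : ∀ n, ContinuousOn (T.iter n ω) (T.fiber ω)) (hfin : T.fiberEntropy ω ≠ ⊤) :
    Tendsto (fun n : ℕ => ((coverD (T.iterCover α n ω) : ℕ∞) : ℝ≥0∞) / n) atTop (𝓝 0) :=
  tendsto_div_natCast_zero_of_forall_eventually_mul_le fun _ hq =>
    (eventually_mul_coverD_iterCover_le hρδ hs hω hfin hq).mono fun _ hn => by exact_mod_cast hn

theorem mdimCover_le_lintegral_limsup [IsFiniteMeasure P] (hρδ : ρ < δ)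
    (hs : IsSubordinateNet α ρ δ s) :
    T.mdimCover α ≤
      ∫⁻ ω, limsup (fun n : ℕ => ((coverD (T.iterCover α n ω) : ℕ∞) : ℝ≥0∞) / n) atTop ∂P := by
  have hbound (n : ℕ) :
      (fun ω => ((coverD (T.iterCover α n ω) : ℕ∞) : ℝ≥0∞) / n) ≤ᵐ[P] fun _ => (#s : ℝ≥0∞) := by
    filter_upwards [T.ae_continuousOn_iter] with ω hω
    refine ENNReal.div_le_of_le_mul ?_
    rw [mul_comm]
    exact_mod_cast coverD_iterCover_le_mul_card hρδ hs hω n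
  calc T.mdimCover α
      ≤ limsup (fun n : ℕ => ∫⁻ ω, ((coverD (T.iterCover α n ω) : ℕ∞) : ℝ≥0∞) / n ∂P) atTop :=
        limsup_le_limsup <| .of_forall fun n => by
          simpa only [div_eq_mul_inv] using lintegral_mul_const_le _ _
    _ ≤ _ := limsup_lintegral_le_lintegral_limsup hbound <| by
        rw [lintegral_const]
        exact ENNReal.mul_ne_top (ENNReal.natCast_ne_top _) (measure_ne_top _ _)

end CoverBounds

end BundleRDS

/-- Since `T.fiberEntropy` is not known to be measurable, its almost sure finiteness is expressed by
saying that the set where it is infinite has inner measure zero. -/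
theorem mainTheorem3_general {Ω X : Type*} [MeasurableSpace Ω] (P : Measure Ω) [IsFiniteMeasure P]
    [MetricSpace X] [CompactSpace X] [MeasurableSpace X] (T : BundleRDS Ω X P)
    (hT : ∀ A ⊆ {ω | T.fiberEntropy ω = ⊤}, MeasurableSet A → P A = 0) :
    T.mdim = 0 := by
  refine le_antisymm (iSup₂_le fun α hα => ?_) bot_le
  obtain ⟨ρ, δ, hρδ, s, hs⟩ := hα.exists_isSubordinateNet
  refine (BundleRDS.mdimCover_le_lintegral_limsup hρδ hs).trans_eq
    (lintegral_eq_zero_of_ae_ne_zero_imp_mem ?_ hT)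
  filter_upwards [T.ae_continuousOn_iter] with ω hω hne
  by_contra hfin
  exact hne (BundleRDS.tendsto_coverD_iterCover_div hρδ hs hω hfin).limsup_eq

theorem mainTheorem3 {Ω X : Type*} [MeasurableSpace Ω] (P : Measure Ω) [IsProbabilityMeasure P]
    [P.IsComplete] [MetricSpace X] [CompactSpace X] [MeasurableSpace X] [BorelSpace X]
    (T : BundleRDS Ω X P) (hT : T.topEntropy < ⊤) :
    T.mdim = 0 :=
  mainTheorem3_general P T fun _ hA hA_meas =>
    measure_eq_zero_of_subset_setOf_eq_top hT.ne hA_meas hA
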